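/- Theorem 2.1. Let $p>3$ be a prime, and let $\mathbb Z_p$ denote the ring of rational numbers whose denominator is not divisible by $p$. Let $\left(\frac{p}{3}\right)$ be the Legendre symbol, let $[x]$ be the greatest integer not exceeding $x$, and let $U_n(P,Q)$ be the Lucas sequence given by $U_0=0$, $U_1=1$, $U_{n+1}=PU_n-QU_{n-1}$ $(n\ge 1)$. Congruences modulo $p$ between rational numbers are taken in $\mathbb Z_p$ (so $x\equiv y\pmod p$ means $x-y\in p\,\mathbb Z_p$); the congruence in (iii) is taken in the ring of complex numbers that are integral over $\mathbb Z_p$. A cubic congruence "has three solutions" if it has exactly three solutions $x$ in $\{0,1,\dots,p-1\}$. Let $a\in\mathbb Z_p$ with $a\not\equiv 0,\frac19,\frac1{27},\frac4{27}\pmod p$, and let $\sqrt{81a^2-12a}$ denote either one of the two complex square roots of $81a^2-12a$. Then the following statements are equivalent: (i) $\displaystyle\sum_{k=1}^{[p/3]}\binom{3k}{k}a^k\equiv 0\pmod p$; (ii) $U_{(p-(\frac p3))/3}(9a,3a)\equiv 0\pmod p$; (iii) $\displaystyle\left(\frac{27a-2+3\sqrt{81a^2-12a}}{2}\right)^{(p-(\frac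 p3))/3}\equiv 1\pmod p$; (iv) the congruence $ax^3-x-1\equiv 0\pmod p$ has three solutions; (v) $\displaystyle\sum_{k=1}^{[p/3]}\binom{3k}{k}\left(\frac{4-27a}{27}\right)^k\equiv 0\pmod p$; (vi) the congruence $(27a-4)x^3+3x+1\equiv 0\pmod p$ has three solutions. -/

import Mathlib

/-- The ring `Z_p` of rational numbers whose (reduced) denominator is not divisible by the
prime `p`, as a subring of `ℚ`. -/
def rationalPIntegers (p : ℕ) [hp : Fact p.Prime] : Subring ℚ where
  carrier := {q : ℚ | ¬ p ∣ q.den}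
  mul_mem' := by
    intro x y hx hy h
    rcases (Nat.Prime.dvd_mul hp.out).1 (h.trans (Rat.mul_den_dvd x y)) with h' | h'
    · exact hx h'
    · exact hy h'
  one_mem' := by
    simpa using hp.out.one_lt.ne'
  add_mem' := by
    intro x y hx hy h
    rcases (Nat.Prime.dvd_mul hp.out).1 (h.trans (Rat.add_den_dvd x y)) with h' | h'
    · exact hx h'
    · exact hy h'
  zero_mem' := by
    simpa using hp.out.one_lt.ne'
  neg_mem' := by
    intro x hx
    simpa using hx

/-- The ring of complex numbers that are integral over `Z_p`. -/
noncomputable def complexPIntegers (p : ℕ) [Fact p.Prime] : Subring ℂ :=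
  (integralClosure (rationalPIntegers p) ℂ).toSubring

/-- `x ≡ y (mod p)` in the subring `R` of `K`: the difference `x - y` lies in `p R`. -/
def CongrMod {K : Type*} [CommRing K] (R : Subring K) (p : ℕ) (x y : K) : Prop :=
  ∃ z ∈ R, x - y = (p : K) * z

/-- The Lucas sequence `U_n(P, Q)`. -/
def lucasU {R : Type*} [CommRing R] (P Q : R) : ℕ → R
  | 0 => 0
  | 1 => 1
  | n + 2 => P * lucasU P Q (n + 1) - Q * lucasU P Q n

/-- The exponent `(p - (p/3)) / 3`, where `(p/3)` is the Legendre symbol. The division is exact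
and the result is positive for every prime `p > 3`. -/
def cubicExponent (p : ℕ) : ℕ :=
  (((p : ℤ) - legendreSym 3 (p : ℤ)) / 3).toNat

/-- The number of solutions `x` modulo `p` of the congruence
`a₀ x³ + a₁ x² + a₂ x + a₃ ≡ 0 (mod p)`, with coefficients in `Z_p`. -/
noncomputable def numCubicSolutions (p : ℕ) [Fact p.Prime] (a₀ a₁ a₂ a₃ : ℚ) : ℕ :=
  Set.ncard {x : ℕ | x < p ∧ CongrMod (rationalPIntegers p) p
    (a₀ * (x : ℚ) ^ 3 + a₁ * (x : ℚ) ^ 2 + a₂ * (x : ℚ) + a₃) 0}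

/-! Write `A` for the residue of `a`, `N` for `cubicExponent p`, and choose `b` in an algebraic
closure of `ZMod p` with `b + b⁻¹ = 27A - 2`. Each of the six conditions is equivalent to `b ^ N =
1`.

For (i), put `n = p / 3`. Modulo `p` the sum plus its `k = 0` term is a Chebyshev polynomial of the
third kind at `d = -b`, equal to `(d^(n+1) + d^(-n)) / (d + 1)`. It is `1` iff `d^n = 1` or `d^(n+1)
= 1`. As `d + d⁻¹` lies in the prime field, Frobenius fixes or inverts `d`; with the excluded
residues this rules out the exponent other than `N`, and `N` is even, so the sign is harmless.
Condition (v) is (i) with `b` replaced by `-b`.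

For (ii), the characteristic roots of the Lucas sequence have ratio `b`. For (iii), the base has
norm `1` and trace `27a - 2`, and the congruence is read off from the trace of its power
(`congrMod_pow_one_iff`).

Both cubics in (iv) and (vi) transform into `z³ - 3z = 27A - 2`, whose roots are `g + g⁻¹` with `g³
= b`. They all lie in `ZMod p` iff `b ^ N = 1` (`ncard_chebyshev_cubic_eq_three_iff`). -/

/-! ### Binomial sums and Chebyshev polynomials -/

open Finset in
/-- For `n ∈ {(p-1)/3, (p-2)/3}` the numbers `C(3k,k)` are congruent to the coefficients of a Chebyshev
polynomial of the third kind. -/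
theorem cast_choose_three_mul {p : ℕ} [Fact p.Prime] (n : ℕ)
    (hpn : p = 3 * n + 1 ∨ p = 3 * n + 2) (k : ℕ) (hk : k ≤ n) :
    (Nat.choose (3 * k) k : ZMod p) = (-27) ^ k * Nat.choose (n + k) (2 * k) := by
  induction k with
  | zero => simp
  | succ k ih =>
    have ih := ih (by omega)
    have h1 : Nat.choose (3 * (k + 1)) (k + 1) * ((2 * k + 1) * (2 * k + 2)) =
        Nat.choose (3 * k) k * (3 * (3 * k + 1) * (3 * k + 2)) := by
      have e1 := Nat.add_one_mul_choose_eq (3 * k + 2) k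
      have e2 := Nat.choose_mul_succ_eq (3 * k + 1) k
      have e3 := Nat.choose_mul_succ_eq (3 * k) k
      rw [show 3 * k + 1 + 1 - k = 2 * k + 2 by omega] at e2
      rw [show 3 * k + 1 - k = 2 * k + 1 by omega] at e3
      have e4 : Nat.choose (3 * (k + 1)) (k + 1) = 3 * Nat.choose (3 * k + 2) k := by
        have : Nat.choose (3 * (k + 1)) (k + 1) * (k + 1) = 3 * Nat.choose (3 * k + 2) k * (k + 1) := by
          rw [show 3 * (k + 1) = 3 * k + 2 + 1 by ring, ← e1]; ring
        exact Nat.eq_of_mul_eq_mul_right (by omega) this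
      rw [e4]
      calc _ = 3 * (2 * k + 1) * (Nat.choose (3 * k + 1 + 1) k * (2 * k + 2)) := by ring
        _ = 3 * (3 * k + 1 + 1) * (Nat.choose (3 * k + 1) k * (2 * k + 1)) := by rw [← e2]; ring
        _ = _ := by rw [← e3]; ring
    have h2 : Nat.choose (n + (k + 1)) (2 * (k + 1)) * ((2 * k + 1) * (2 * k + 2)) =
        Nat.choose (n + k) (2 * k) * ((n + k + 1) * (n - k)) := by
      have e1 := Nat.add_one_mul_choose_eq (n + k) (2 * k + 1)
      have e2 := Nat.choose_succ_right_eq (n + k) (2 * k)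
      rw [show n + k - 2 * k = n - k by omega] at e2
      calc _ = (2 * k + 1) * (Nat.choose (n + k + 1) (2 * k + 1 + 1) * (2 * k + 1 + 1)) := by
            rw [show n + (k + 1) = n + k + 1 by ring, show 2 * (k + 1) = 2 * k + 1 + 1 by ring]; ring
        _ = (n + k + 1) * (Nat.choose (n + k) (2 * k + 1) * (2 * k + 1)) := by rw [← e1]; ring
        _ = _ := by rw [e2]; ring
    have hp0 : (p : ZMod p) = 0 := ZMod.natCast_self p
    have hne : ((2 * k + 1 : ℕ) : ZMod p) * ((2 * k + 2 : ℕ) : ZMod p) ≠ 0 := by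
      refine mul_ne_zero ?_ ?_ <;>
      · rw [Ne, ZMod.natCast_eq_zero_iff]
        exact Nat.not_dvd_of_pos_of_lt (by omega) (by omega)
    have h1' := congrArg (Nat.cast : ℕ → ZMod p) h1
    have h2' := congrArg (Nat.cast : ℕ → ZMod p) h2
    have hnk : ((n - k : ℕ) : ZMod p) = n - k := Nat.cast_sub (by omega)
    rw [Nat.cast_mul, Nat.cast_mul] at h1' h2'
    push_cast [hnk] at h1' h2' hne
    refine mul_right_cancel₀ hne ?_
    rw [h1', ih, mul_assoc ((-27 : ZMod p) ^ (k + 1)), h2', pow_succ]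
    -- The right side is `3(3n + 3k + 3)(3k - 3n)`; since `3n` is `-1` or `-2` modulo `p`, its last
    -- two factors are `3k + 1` and `3k + 2` in some order.
    have key : (3 * (3 * (k : ZMod p) + 1) * (3 * k + 2)) = (-27) * ((n + k + 1) * (n - k)) := by
      rcases hpn with h | h
      · have : (3 * n + 1 : ZMod p) = 0 := by
          have := congrArg (Nat.cast : ℕ → ZMod p) h
          rw [hp0] at this
          push_cast at this
          exact this.symm
        linear_combination (9 * (n : ZMod p) + 6) * this
      · have : (3 * n + 2 : ZMod p) = 0 := by
          have := congrArg (Nat.cast : ℕ → ZMod p) h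
          rw [hp0] at this
          push_cast at this
          exact this.symm
        linear_combination (9 * (n : ZMod p) + 3) * this
    linear_combination (-27 : ZMod p) ^ k * (Nat.choose (n + k) (2 * k) : ZMod p) * key

-- Pascal's rule couples the two sums, `A(n+1) = A(n) + y B(n)` and `B(n+1) = B(n) + A(n+1)` with `y
-- = d + e - 2`, so they are evaluated by one induction.
open Finset in
theorem sum_choose_third_kind_and_second_kind {R : Type*} [CommRing R] (d e : R) (hde : d * e = 1) (n : ℕ) :
    (d + 1) * (∑ k ∈ range (n + 1), (Nat.choose (n + k) (2 * k) : R) * (d + e - 2) ^ k) =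
      d ^ (n + 1) + e ^ n ∧
    (d - e) * (∑ k ∈ range (n + 1), (Nat.choose (n + 1 + k) (2 * k + 1) : R) * (d + e - 2) ^ k) =
      d ^ (n + 1) - e ^ (n + 1) := by
  set y := d + e - 2 with hy
  induction n with
  | zero => simp
  | succ n ih =>
    obtain ⟨hA, hB⟩ := ih
    have sA : ∑ k ∈ range (n + 1 + 1), (Nat.choose (n + 1 + k) (2 * k) : R) * y ^ k =
        (∑ k ∈ range (n + 1), (Nat.choose (n + k) (2 * k) : R) * y ^ k) +
        y * ∑ k ∈ range (n + 1), (Nat.choose (n + 1 + k) (2 * k + 1) : R) * y ^ k := by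
      have h0 : ∑ k ∈ range (n + 1), (Nat.choose (n + k) (2 * k) : R) * y ^ k =
          ∑ k ∈ range (n + 1 + 1), (Nat.choose (n + k) (2 * k) : R) * y ^ k := by
        rw [sum_range_succ _ (n + 1), Nat.choose_eq_zero_of_lt (by omega)]; simp
      rw [h0, sum_range_succ' _ (n + 1), sum_range_succ' _ (n + 1), mul_sum,
        show ∀ x y z : R, x + y + z = x + z + y from fun x y z => by ring, ← sum_add_distrib]
      congr 1
      · refine sum_congr rfl fun k _ => ?_
        rw [show n + 1 + (k + 1) = n + 1 + k + 1 by ring, show 2 * (k + 1) = 2 * k + 1 + 1 by ring,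
          Nat.choose_succ_succ, show n + (k + 1) = n + 1 + k by ring]
        push_cast; ring
      · simp
    have sB : ∑ k ∈ range (n + 1 + 1), (Nat.choose (n + 1 + 1 + k) (2 * k + 1) : R) * y ^ k =
        (∑ k ∈ range (n + 1), (Nat.choose (n + 1 + k) (2 * k + 1) : R) * y ^ k) +
        ∑ k ∈ range (n + 1 + 1), (Nat.choose (n + 1 + k) (2 * k) : R) * y ^ k := by
      have h0 : ∑ k ∈ range (n + 1), (Nat.choose (n + 1 + k) (2 * k + 1) : R) * y ^ k =
          ∑ k ∈ range (n + 1 + 1), (Nat.choose (n + 1 + k) (2 * k + 1) : R) * y ^ k := by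
        rw [sum_range_succ _ (n + 1), Nat.choose_eq_zero_of_lt (by omega)]; simp
      rw [h0, ← sum_add_distrib]
      refine sum_congr rfl fun k _ => ?_
      rw [show n + 1 + 1 + k = n + 1 + k + 1 by ring, Nat.choose_succ_succ]
      push_cast; ring
    have hA' : (d + 1) * ∑ k ∈ range (n + 1 + 1), (Nat.choose (n + 1 + k) (2 * k) : R) * y ^ k =
        d ^ (n + 1 + 1) + e ^ (n + 1) := by
      have f : (d + 1) * y = (d - e) * (d - 1) := by rw [hy]; linear_combination 2 * hde
      rw [sA, mul_add, hA, ← mul_assoc, f, mul_right_comm, hB]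
      linear_combination (-e ^ n) * hde
    refine ⟨hA', ?_⟩
    have f : d - e = e * (d - 1) * (d + 1) := by linear_combination (-d) * hde
    rw [sB, mul_add, hB, f, mul_assoc (e * (d - 1)), hA']
    linear_combination (d ^ (n + 2) - d ^ (n+1) + e ^ (n + 1)) * hde

/-- If `S` is the sum, the closed form gives `(d^n - 1)(d^(n+1) - 1) = d^n (d + 1)(S - 1)`. -/
theorem sum_choose_third_kind_eq_one_iff {K : Type*} [Field K] (d : K) (hd : d ≠ 0) (hd1 : d + 1 ≠ 0)
    (n : ℕ) :
    ∑ k ∈ Finset.range (n + 1), (Nat.choose (n + k) (2 * k) : K) * (d + d⁻¹ - 2) ^ k = 1 ↔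
      d ^ n = 1 ∨ d ^ (n + 1) = 1 := by
  have h := (sum_choose_third_kind_and_second_kind d d⁻¹ (mul_inv_cancel₀ hd) n).1
  have hn : d ^ n * d⁻¹ ^ n = 1 := by rw [← mul_pow, mul_inv_cancel₀ hd, one_pow]
  have e : (d ^ n - 1) * (d ^ (n + 1) - 1) = d ^ n * (d + 1) *
      (∑ k ∈ Finset.range (n + 1), (Nat.choose (n + k) (2 * k) : K) * (d + d⁻¹ - 2) ^ k - 1) := by
    linear_combination (-d ^ n) * h - hn
  rw [← sub_eq_zero, ← sub_eq_zero (a := d ^ n), ← sub_eq_zero (a := d ^ (n + 1)), ← mul_eq_zero, e]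
  simp [hd, hd1]

/-! ### Lucas sequences, the exponent, and elements of the form `u + u⁻¹` -/

theorem sub_mul_lucasU {R : Type*} [CommRing R] (x y : R) (n : ℕ) :
    (x - y) * lucasU (x + y) (x * y) n = x ^ n - y ^ n := by
  induction n using Nat.twoStepInduction with
  | zero => simp [lucasU]
  | one => simp [lucasU]
  | more n h1 h2 =>
    rw [lucasU]
    linear_combination (x + y) * h2 - x * y * h1

theorem map_lucasU {R S : Type*} [CommRing R] [CommRing S] (f : R →+* S) (P Q : R) (n : ℕ) :
    f (lucasU P Q n) = lucasU (f P) (f Q) n := by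
  induction n using Nat.twoStepInduction with
  | zero => simp [lucasU]
  | one => simp [lucasU]
  | more n h1 h2 => simp [lucasU, h1, h2]

theorem cubicExponent_cases (p : ℕ) [hp : Fact p.Prime] (hp3 : 3 < p) :
    (p = 3 * (p / 3) + 1 ∧ cubicExponent p = p / 3) ∨
      (p = 3 * (p / 3) + 2 ∧ cubicExponent p = p / 3 + 1) := by
  have h0 : p % 3 ≠ 0 := fun h => by
    have := (Nat.prime_dvd_prime_iff_eq Nat.prime_three hp.out).1 (Nat.dvd_of_mod_eq_zero h)
    omega
  have h12 : p % 3 = 1 ∨ p % 3 = 2 := by omega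
  unfold cubicExponent
  rw [legendreSym.mod]
  rcases h12 with h | h
  · left
    have : ((p : ℤ) % (3 : ℕ)) = 1 := by omega
    rw [this, legendreSym.at_one]
    omega
  · right
    have : ((p : ℤ) % (3 : ℕ)) = 2 := by omega
    have h2 : legendreSym 3 2 = -1 := by decide
    rw [this, h2]
    omega

theorem even_cubicExponent (p : ℕ) [hp : Fact p.Prime] (hp3 : 3 < p) : Even (cubicExponent p) := by
  have h := hp.out.eq_two_or_odd
  have := cubicExponent_cases p hp3
  rw [Nat.even_iff]
  omega

theorem add_inv_eq_add_inv_iff {K : Type*} [Field K] {u v : K} (hu : u ≠ 0) (hv : v ≠ 0) :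
    v + v⁻¹ = u + u⁻¹ ↔ v = u ∨ v = u⁻¹ := by
  have e : v + v⁻¹ - (u + u⁻¹) = (v - u) * (v - u⁻¹) * v⁻¹ := by
    field_simp
    ring
  rw [← sub_eq_zero, e]
  simp [hv, sub_eq_zero]

theorem exists_add_inv_eq {K : Type*} [Field K] [IsAlgClosed K] (c : K) :
    ∃ b : K, b ≠ 0 ∧ b + b⁻¹ = c := by
  obtain ⟨b, hb⟩ := IsAlgClosed.exists_root
    (Polynomial.C 1 * Polynomial.X ^ 2 + Polynomial.C (-c) * Polynomial.X + Polynomial.C 1)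
    (by rw [Polynomial.degree_quadratic one_ne_zero]; decide)
  simp only [Polynomial.IsRoot, Polynomial.eval_add, Polynomial.eval_mul, Polynomial.eval_C,
    Polynomial.eval_pow, Polynomial.eval_X] at hb
  have hb0 : b ≠ 0 := by
    rintro rfl
    simp at hb
  refine ⟨b, hb0, ?_⟩
  field_simp
  linear_combination hb

/-- Three times the exponent is `p - 1` or `p + 1`, so the condition on `b` says that Frobenius
fixes, respectively inverts, a cube root of `b`. -/
theorem pow_cubicExponent_eq_one_iff {p : ℕ} [Fact p.Prime] (hp3 : 3 < p) {K : Type*} [Field K]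
    {b g : K} (hg : g ^ 3 = b) (hg0 : g ≠ 0) :
    b ^ cubicExponent p = 1 ↔ (p % 3 = 1 ∧ g ^ p = g) ∨ (p % 3 = 2 ∧ g ^ p = g⁻¹) := by
  rw [← hg, ← pow_mul]
  rcases cubicExponent_cases p hp3 with ⟨h, h'⟩ | ⟨h, h'⟩
  · rw [h']
    have h1 : p % 3 = 1 := by omega
    have e : g ^ p = g ^ (3 * (p / 3)) * g := by
      rw [← pow_succ]; congr 1
    simp [h1, e, hg0]
  · rw [h']
    have h1 : p % 3 = 2 := by omega
    have e : g ^ (3 * (p / 3 + 1)) = g ^ p * g := by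
      rw [← pow_succ]; congr 1; omega
    simp [h1, e, ← mul_eq_one_iff_eq_inv₀ hg0]

/-! ### Frobenius and rationality over the prime field -/

section PrimeField

variable {p : ℕ} [hp : Fact p.Prime] {K : Type*} [Field K] [Algebra (ZMod p) K]

theorem mem_range_algebraMap_zmod_iff (x : K) : x ∈ Set.range (algebraMap (ZMod p) K) ↔ x ^ p = x := by
  have : CharP K p := charP_of_injective_algebraMap (algebraMap (ZMod p) K).injective p
  rw [← Subfield.mem_bot_iff_pow_eq_self, ← ZMod.fieldRange_castHom_eq_bot p,
    Subsingleton.elim (ZMod.castHom (dvd_refl p) K) (algebraMap (ZMod p) K)]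
  rfl

theorem add_inv_mem_range_algebraMap_zmod_iff {u : K} (hu : u ≠ 0) :
    u + u⁻¹ ∈ Set.range (algebraMap (ZMod p) K) ↔ u ^ p = u ∨ u ^ p = u⁻¹ := by
  have : CharP K p := charP_of_injective_algebraMap (algebraMap (ZMod p) K).injective p
  rw [mem_range_algebraMap_zmod_iff, add_pow_char, inv_pow,
    add_inv_eq_add_inv_iff hu (pow_ne_zero _ hu)]

/-- The roots are `u + u⁻¹` for the three cube roots `u` of `b`, distinct because `b² ≠ 1`. Such a
root is in the prime field iff Frobenius fixes or inverts `u`. -/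
theorem ncard_chebyshev_cubic_eq_three_iff [IsAlgClosed K] (hp3 : 3 < p) (c : ZMod p) {b : K}
    (hb : b ≠ 0) (hbc : b + b⁻¹ = algebraMap (ZMod p) K c) (hb2 : b ^ 2 ≠ 1) :
    {z : ZMod p | z ^ 3 - 3 * z = c}.ncard = 3 ↔ b ^ cubicExponent p = 1 := by
  have : CharP K p := charP_of_injective_algebraMap (algebraMap (ZMod p) K).injective p
  obtain ⟨g, hg⟩ := IsAlgClosed.exists_pow_nat_eq b (n := 3) (by norm_num)
  have hg0 : g ≠ 0 := by rintro rfl; simp at hg; exact hb hg.symm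
  have h3 : (3 : K) ≠ 0 := by
    have : ((3 : ℕ) : K) ≠ 0 := by
      rw [Ne, CharP.cast_eq_zero_iff K p]
      exact Nat.not_dvd_of_pos_of_lt (by omega) hp3
    exact_mod_cast this
  -- `w + w⁻¹ = -1` makes `w` a primitive cube root of unity.
  obtain ⟨w, hw0, hw1⟩ := exists_add_inv_eq (-1 : K)
  have hw : w ^ 2 + w + 1 = 0 := by
    field_simp at hw1
    linear_combination hw1
  have hw3 : w ^ 3 = 1 := by linear_combination (w - 1) * hw
  have hwne : w ≠ 1 := by
    rintro rfl
    apply h3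
    linear_combination hw
  have hw2ne : w ^ 2 ≠ 1 := by
    intro h
    apply hwne
    linear_combination hw3 - w * h
  have hg6 : g ^ 6 ≠ 1 := by
    intro h
    apply hb2
    rw [← hg, ← h]; ring
  have hwi : w⁻¹ = w ^ 2 := by
    field_simp
    exact hw3.symm
  have root : ∀ u : K, u ≠ 0 → u ^ 3 = b → (u + u⁻¹) ^ 3 - 3 * (u + u⁻¹) = algebraMap (ZMod p) K c := by
    intro u hu h
    rw [← hbc, ← h]
    field_simp
    ring
  have ne : ∀ u v : K, u ^ 3 = b → v ^ 3 = b → u ≠ v → u + u⁻¹ ≠ v + v⁻¹ := by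
    intro u v hu hv huv h
    have hu0 : u ≠ 0 := by rintro rfl; simp at hu; exact hb hu.symm
    have hv0 : v ≠ 0 := by rintro rfl; simp at hv; exact hb hv.symm
    rcases (add_inv_eq_add_inv_iff hv0 hu0).1 h with h | h
    · exact huv h
    · apply hb2
      rw [← mul_eq_one_iff_eq_inv₀ hv0] at h
      calc b ^ 2 = u ^ 3 * v ^ 3 := by rw [hu, hv]; ring
        _ = (u * v) ^ 3 := by ring
        _ = 1 := by rw [h, one_pow]
  have h2 : (g * w) ^ 3 = b := by rw [mul_pow, hw3, mul_one, hg]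
  have h3' : (g * w ^ 2) ^ 3 = b := by
    rw [mul_pow, ← pow_mul, show w ^ (2 * 3) = (w ^ 3) ^ 2 by ring, hw3, one_pow, mul_one, hg]
  have hgw0 : g * w ≠ 0 := mul_ne_zero hg0 hw0
  have hgw20 : g * w ^ 2 ≠ 0 := mul_ne_zero hg0 (pow_ne_zero _ hw0)
  set z0 := g + g⁻¹ with hz0
  set z1 := g * w + (g * w)⁻¹ with hz1
  set z2 := g * w ^ 2 + (g * w ^ 2)⁻¹ with hz2
  have n01 : z0 ≠ z1 := ne _ _ hg h2 (by
    intro h; apply hwne; exact mul_left_cancel₀ hg0 (by rw [← h, mul_one]))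
  have n02 : z0 ≠ z2 := ne _ _ hg h3' (by
    intro h; apply hw2ne; exact mul_left_cancel₀ hg0 (by rw [← h, mul_one]))
  have n12 : z1 ≠ z2 := ne _ _ h2 h3' (by
    intro h; apply hwne
    have := mul_left_cancel₀ hg0 h
    exact mul_left_cancel₀ hw0 (by rw [mul_one, ← pow_two, ← this]))
  have factor : ∀ z : K, z ^ 3 - 3 * z - algebraMap (ZMod p) K c = (z - z0) * (z - z1) * (z - z2) := by
    have s1 : z0 + z1 + z2 = 0 := by
      rw [hz0, hz1, hz2, mul_inv, mul_inv, ← inv_pow, hwi]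
      linear_combination (g + g⁻¹) * hw + g⁻¹ * w * hw3
    intro z
    have r0 := root g hg0 hg
    have r1 := root _ hgw0 h2
    rw [← hz0] at r0
    rw [← hz1] at r1
    have s2 : z0 ^ 2 + z0 * z1 + z1 ^ 2 = 3 := by
      apply mul_left_cancel₀ (sub_ne_zero.2 n01)
      linear_combination r0 - r1
    have e2 : z2 = -z0 - z1 := by linear_combination s1
    rw [e2]
    linear_combination (z - z0) * s2 + r0
  have himg : algebraMap (ZMod p) K '' {z : ZMod p | z ^ 3 - 3 * z = c} ⊆ {z0, z1, z2} := by
    rintro _ ⟨z, hz, rfl⟩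
    have := factor (algebraMap (ZMod p) K z)
    have hz' := congrArg (algebraMap (ZMod p) K) hz
    simp only [map_sub, map_mul, map_pow, map_ofNat] at hz'
    rw [hz', sub_self, eq_comm, mul_eq_zero, mul_eq_zero, sub_eq_zero, sub_eq_zero, sub_eq_zero] at this
    simp only [Set.mem_insert_iff, Set.mem_singleton_iff]
    tauto
  have hcard : ({z0, z1, z2} : Set K).ncard = 3 := by
    rw [Set.ncard_eq_three]
    exact ⟨z0, z1, z2, n01, n02, n12, rfl⟩
  rw [← Set.ncard_image_of_injective _ (algebraMap (ZMod p) K).injective]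
  have step : (algebraMap (ZMod p) K '' {z : ZMod p | z ^ 3 - 3 * z = c}).ncard = 3 ↔
      (z0 ∈ Set.range (algebraMap (ZMod p) K) ∧ z1 ∈ Set.range (algebraMap (ZMod p) K) ∧
        z2 ∈ Set.range (algebraMap (ZMod p) K)) := by
    constructor
    · intro h
      have heq := Set.eq_of_subset_of_ncard_le himg (by rw [h, hcard])
        (Set.toFinite _)
      refine ⟨?_, ?_, ?_⟩ <;> apply Set.image_subset_range _ {z : ZMod p | z ^ 3 - 3 * z = c} <;>
        rw [heq] <;> simp
    · rintro ⟨⟨y0, hy0⟩, ⟨y1, hy1⟩, ⟨y2, hy2⟩⟩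
      suffices h : algebraMap (ZMod p) K '' {z : ZMod p | z ^ 3 - 3 * z = c} = {z0, z1, z2} by
        rw [h, hcard]
      refine himg.antisymm ?_
      rintro _ (rfl | rfl | rfl)
      · refine ⟨y0, (algebraMap (ZMod p) K).injective ?_, hy0⟩
        simpa only [map_sub, map_mul, map_pow, map_ofNat, hy0] using root g hg0 hg
      · refine ⟨y1, (algebraMap (ZMod p) K).injective ?_, hy1⟩
        simpa only [map_sub, map_mul, map_pow, map_ofNat, hy1] using root _ hgw0 h2
      · refine ⟨y2, (algebraMap (ZMod p) K).injective ?_, hy2⟩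
        simpa only [map_sub, map_mul, map_pow, map_ofNat, hy2] using root _ hgw20 h3'
  rw [step, pow_cubicExponent_eq_one_iff hp3 hg hg0, add_inv_mem_range_algebraMap_zmod_iff hg0,
    add_inv_mem_range_algebraMap_zmod_iff hgw0, add_inv_mem_range_algebraMap_zmod_iff hgw20]
  have hginv : g ≠ g⁻¹ := by
    intro h
    rw [← mul_eq_one_iff_eq_inv₀ hg0] at h
    apply hg6
    calc g ^ 6 = (g * g) ^ 3 := by ring
      _ = 1 := by rw [h, one_pow]
  have hwinv : w ≠ w⁻¹ := by
    intro h
    rw [← mul_eq_one_iff_eq_inv₀ hw0] at h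
    exact hw2ne (by rw [pow_two, h])
  have hwp : (p % 3 = 1 ∧ w ^ p = w) ∨ (p % 3 = 2 ∧ w ^ p = w⁻¹) :=
    (pow_cubicExponent_eq_one_iff hp3 hw3 hw0).1 (one_pow _)
  rw [mul_pow, mul_pow, mul_inv, mul_inv, ← pow_mul, mul_comm 2 p, pow_mul, ← inv_pow]
  rcases hwp with ⟨h1, h⟩ | ⟨h1, h⟩
  -- Here Frobenius fixes `w`. If it inverted `g`, it would send `g w` to `g⁻¹ w`, which is neither
  -- `g w` nor its inverse. The case where `w` is inverted is symmetric.
  · simp only [h1, h, true_and, false_and, or_false, OfNat.one_ne_ofNat]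
    constructor
    · rintro ⟨h0 | h0, hh, -⟩
      · exact h0
      · rw [h0] at hh
        rcases hh with hh | hh
        · exact absurd (mul_right_cancel₀ hw0 hh).symm hginv
        · exact absurd (mul_left_cancel₀ (inv_ne_zero hg0) hh) hwinv
    · intro h0
      simp [h0]
  · simp only [h1, h, true_and, false_and, false_or, OfNat.ofNat_ne_one]
    constructor
    · rintro ⟨h0 | h0, hh, -⟩
      · rw [h0] at hh
        rcases hh with hh | hh
        · exact absurd (mul_left_cancel₀ hg0 hh).symm hwinv
        · exact absurd (mul_right_cancel₀ (inv_ne_zero hw0) hh) hginv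
      · exact h0
    · intro h0
      simp [h0]

theorem sum_choose_third_kind_eq_one_iff_pow_cubicExponent (hp3 : 3 < p) (c : ZMod p) {b : K} (hb : b ≠ 0)
    (hbc : b + b⁻¹ = algebraMap (ZMod p) K c) (hc2 : c ≠ 2) (hc2' : c ≠ -2) (hc1 : c ≠ 1) :
    ∑ k ∈ Finset.range (p / 3 + 1), (Nat.choose (p / 3 + k) (2 * k) : ZMod p) * (-c - 2) ^ k = 1 ↔
      b ^ cubicExponent p = 1 := by
  have inj := (algebraMap (ZMod p) K).injective
  have hb1 : b ≠ 1 := by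
    rintro rfl
    exact hc2 (inj (by rw [← hbc, inv_one, map_ofNat]; norm_num))
  have hb1' : b ≠ -1 := by
    rintro rfl
    exact hc2' (inj (by rw [← hbc, inv_neg, inv_one, map_neg, map_ofNat]; norm_num))
  have h3 : (-b) ^ 3 ≠ 1 := by
    intro h
    have : (b + 1) * (b ^ 2 - b + 1) = 0 := by linear_combination -h
    rcases mul_eq_zero.1 this with h | h
    · exact hb1' (by linear_combination h)
    · apply hc1
      apply inj
      rw [← hbc, map_one]
      field_simp
      linear_combination h
  have hd0 : -b ≠ 0 := neg_ne_zero.2 hb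
  have hfrob : (-b) ^ p = -b ∨ (-b) ^ p = (-b)⁻¹ := by
    rw [← add_inv_mem_range_algebraMap_zmod_iff hd0]
    exact ⟨-c, by rw [map_neg, ← hbc, inv_neg]; ring⟩
  have key := sum_choose_third_kind_eq_one_iff (-b) hd0
    (by intro h; apply hb1; linear_combination -h) (p / 3)
  rw [← inj.eq_iff, map_sum, map_one]
  simp only [map_mul, map_pow, map_natCast, map_sub, map_neg, map_ofNat, ← hbc]
  rw [show -(b + b⁻¹) - 2 = -b + (-b)⁻¹ - 2 by rw [inv_neg]; ring, key,
    ← (even_cubicExponent p hp3).neg_pow b]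
  rcases cubicExponent_cases p hp3 with ⟨h, h'⟩ | ⟨h, h'⟩
  -- The unwanted alternative `d^(n+1) = 1`, with `d = -b`, gives `d^(p+2) = 1`; Frobenius then
  -- forces `d³ = 1` or `d = 1`. In the other case `d^n = 1` gives `d^p = d²`, with the same
  -- outcome.
  · rw [h', or_iff_left]
    intro hh
    have e : (-b) ^ p * (-b) ^ 2 = 1 := by
      rw [← pow_add, show p + 2 = (p / 3 + 1) * 3 by omega, pow_mul, hh, one_pow]
    rcases hfrob with hf | hf
    · exact h3 (by rw [← e, hf]; ring)
    · rw [hf] at e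
      have : -b = 1 := by rw [← e]; field_simp
      exact hb1' (by linear_combination -this)
  · rw [h', or_iff_right]
    intro hh
    have e : (-b) ^ p = (-b) ^ 2 := by
      have : (-b) ^ p = (-b) ^ (p / 3 * 3 + 2) := by congr 1; omega
      rw [this, pow_add, pow_mul, hh, one_pow, one_mul]
    rcases hfrob with hf | hf
    · rw [hf] at e
      have : -b = 1 := mul_left_cancel₀ hd0 (by rw [mul_one, ← pow_two, ← e])
      exact hb1' (by linear_combination -this)
    · apply h3
      rw [pow_succ, ← e, hf, inv_mul_cancel₀ hd0]

end PrimeField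

/-! ### Reduction modulo `p` and integrality over `Z_p` -/

section Residue

variable (p : ℕ) [hp : Fact p.Prime]

theorem den_cast_ne_zero (x : rationalPIntegers p) : ((x : ℚ).den : ZMod p) ≠ 0 := by
  rw [Ne, ZMod.natCast_eq_zero_iff]
  exact x.2

/-- The reduction map `Z_p → ℤ/pℤ`. -/
def residueMap : rationalPIntegers p →+* ZMod p where
  toFun x := ((x : ℚ) : ZMod p)
  map_one' := Rat.cast_one
  map_zero' := Rat.cast_zero
  map_mul' x y := Rat.cast_mul_of_ne_zero (den_cast_ne_zero p x) (den_cast_ne_zero p y)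
  map_add' x y := Rat.cast_add_of_ne_zero (den_cast_ne_zero p x) (den_cast_ne_zero p y)

variable {p}

theorem residueMap_apply (x : rationalPIntegers p) :
    residueMap p x = ((x : ℚ).num : ZMod p) / ((x : ℚ).den : ZMod p) := Rat.cast_def _

theorem residueMap_eq_zero_iff_dvd_num (x : rationalPIntegers p) :
    residueMap p x = 0 ↔ (p : ℤ) ∣ (x : ℚ).num := by
  rw [residueMap_apply, div_eq_zero_iff, or_iff_left (den_cast_ne_zero p x),
    ZMod.intCast_zmod_eq_zero_iff_dvd]

theorem intCast_div_mem (n : ℤ) (d : ℕ) (hd : ¬ p ∣ d) : (n / d : ℚ) ∈ rationalPIntegers p := by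
  intro h
  apply hd
  have := Rat.den_dvd n d
  rw [Rat.divInt_eq_div] at this
  exact_mod_cast (Int.natCast_dvd_natCast.2 h).trans this

theorem residueMap_eq_zero_iff (x : rationalPIntegers p) : residueMap p x = 0 ↔ (p : rationalPIntegers p) ∣ x := by
  constructor
  · rw [residueMap_eq_zero_iff_dvd_num]
    rintro ⟨n, hn⟩
    refine ⟨⟨n / (x : ℚ).den, intCast_div_mem n _ x.2⟩, Subtype.ext ?_⟩
    conv_lhs => rw [← Rat.num_div_den (x : ℚ), hn]
    push_cast
    ring
  · rintro ⟨z, rfl⟩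
    simp

theorem congrMod_iff_residueMap_eq (x y : rationalPIntegers p) :
    CongrMod (rationalPIntegers p) p (x : ℚ) y ↔ residueMap p x = residueMap p y := by
  rw [← sub_eq_zero, ← map_sub, residueMap_eq_zero_iff]
  constructor
  · rintro ⟨z, hz, h⟩
    exact ⟨⟨z, hz⟩, Subtype.ext (by simpa using h)⟩
  · rintro ⟨z, h⟩
    exact ⟨z, z.2, by simpa using congrArg (Subtype.val) h⟩

theorem inv_mem_rationalPIntegers (x : rationalPIntegers p) (hx : residueMap p x ≠ 0) :
    (x : ℚ)⁻¹ ∈ rationalPIntegers p := by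
  rw [Ne, residueMap_eq_zero_iff_dvd_num] at hx
  change ¬ p ∣ (x : ℚ)⁻¹.den
  rw [Rat.den_inv]
  split_ifs with h
  · simp [h] at hx
  · rwa [← Int.natCast_dvd]

theorem mem_or_inv_mem_rationalPIntegers (q : ℚ) :
    q ∈ rationalPIntegers p ∨ q⁻¹ ∈ rationalPIntegers p := by
  by_cases h : p ∣ q.den
  · right
    change ¬ p ∣ q⁻¹.den
    rw [Rat.den_inv]
    split_ifs with h0
    · exact hp.out.one_lt.ne' ∘ Nat.dvd_one.1
    · intro h'
      exact Nat.not_coprime_of_dvd_of_dvd hp.out.one_lt h' h q.reduced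
  · exact Or.inl h

/-- `Z_p` is a valuation ring of `ℚ`, hence integrally closed. -/
theorem mem_rationalPIntegers_of_isIntegral (q : ℚ) (h : IsIntegral (rationalPIntegers p) q) :
    q ∈ rationalPIntegers p := by
  let V : ValuationSubring ℚ := ⟨rationalPIntegers p, mem_or_inv_mem_rationalPIntegers⟩
  have h' : IsIntegral V q := h
  obtain ⟨y, hy⟩ := IsIntegrallyClosed.isIntegral_iff.1 h'
  rw [← hy]
  exact y.2

theorem mem_rationalPIntegers_of_mem_complexPIntegers (q : ℚ) (h : (q : ℂ) ∈ complexPIntegers p) :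
    q ∈ rationalPIntegers p := by
  have h' : IsIntegral (rationalPIntegers p) (algebraMap ℚ ℂ q) := h
  exact mem_rationalPIntegers_of_isIntegral q
    ((isIntegral_algebraMap_iff (algebraMap ℚ ℂ).injective).1 h')

theorem algebraMap_mem_complexPIntegers (x : rationalPIntegers p) : ((x : ℚ) : ℂ) ∈ complexPIntegers p :=
  isIntegral_algebraMap (R := rationalPIntegers p) (A := ℂ) (x := x)

/-- For `x` of norm one and trace `c ∈ Z_p` with `c² ≢ 4`, the congruence `xⁿ ≡ 1 (mod p)` among
`p`-integral complex numbers is detected by the trace of `xⁿ`. -/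
theorem congrMod_pow_one_iff (hp3 : 3 < p) (c : rationalPIntegers p) (x y : ℂ) (hxy : x * y = 1)
    (hc : x + y = (c : ℚ)) (hc4 : residueMap p (c ^ 2 - 4) ≠ 0) (n : ℕ) :
    CongrMod (complexPIntegers p) p (x ^ n) 1 ↔
      residueMap p ((Polynomial.dickson 1 1 n).eval c) = 2 := by
  set V := (Polynomial.dickson 1 (1 : rationalPIntegers p) n).eval c with hV
  set U := lucasU c 1 n with hU
  let f : rationalPIntegers p →+* ℂ := algebraMap (rationalPIntegers p) ℂ
  have hf : ∀ z, f z = ((z : ℚ) : ℂ) := fun z => rfl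
  have hinj : Function.Injective f := fun a b h => by
    rw [hf, hf] at h
    exact Subtype.ext (Rat.cast_injective h)
  have hcf : f c = x + y := by rw [hf, hc]
  have hVf : f V = x ^ n + y ^ n := by
    rw [hV, ← Polynomial.eval_map_apply, Polynomial.map_dickson, map_one, hcf,
      Polynomial.dickson_one_one_eval_add_inv x y hxy]
  have hUf : (x - y) * f U = x ^ n - y ^ n := by
    rw [hU, map_lucasU, hcf, map_one, ← hxy, sub_mul_lucasU]
  have hxyn : x ^ n * y ^ n = 1 := by rw [← mul_pow, hxy, one_pow]
  have hVU : (V - 2) * (V + 2) = (c ^ 2 - 4) * U ^ 2 := by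
    apply hinj
    simp only [map_mul, map_sub, map_add, map_pow, map_ofNat, hVf, hcf]
    have : ((x + y) ^ 2 - 4) * f U ^ 2 = ((x - y) * f U) ^ 2 := by
      linear_combination 4 * f U ^ 2 * hxy
    rw [this, hUf]
    linear_combination 4 * hxyn
  have hp0 : (p : rationalPIntegers p) ≠ 0 := by
    exact_mod_cast hp.out.ne_zero
  have hp0' : (p : ℂ) ≠ 0 := by exact_mod_cast hp.out.ne_zero
  have h4 : (4 : ZMod p) ≠ 0 := by
    have : ((2 : ℕ) : ZMod p) ≠ 0 := by
      rw [Ne, ZMod.natCast_eq_zero_iff]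
      exact Nat.not_dvd_of_pos_of_lt (by omega) (by omega)
    have h2 := mul_ne_zero this this
    norm_num at h2
    exact h2
  have hint : ∀ z w : ℂ, z * w = 1 → z + w = (c : ℚ) → z ∈ complexPIntegers p := by
    intro z w hzw hz
    refine ⟨Polynomial.X ^ 2 - Polynomial.C c * Polynomial.X + Polynomial.C 1, by monicity!, ?_⟩
    simp only [Polynomial.eval₂_add, Polynomial.eval₂_sub, Polynomial.eval₂_mul, Polynomial.eval₂_pow,
      Polynomial.eval₂_X, Polynomial.eval₂_C]
    change z ^ 2 - f c * z + f 1 = 0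
    rw [hf c, ← hz, map_one, ← hzw]
    ring
  have hx : x ∈ complexPIntegers p := hint x y hxy hc
  have hy : y ∈ complexPIntegers p := hint y x (by rw [mul_comm, hxy]) (by rw [add_comm, hc])
  constructor
  · rintro ⟨z, hz, h⟩
    -- `V - 2 = (x^n - 1)² y^n`, so the quotient is a rational number integral over `Z_p`.
    have hq : (((V : ℚ) - 2) / p : ℚ) ∈ rationalPIntegers p := by
      apply mem_rationalPIntegers_of_mem_complexPIntegers
      have : ((((V : ℚ) - 2) / p : ℚ) : ℂ) = p * z ^ 2 * y ^ n := by
        push_cast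
        rw [div_eq_iff hp0', ← hf, hVf]
        have : (p * z ^ 2 * y ^ n * p : ℂ) = (x ^ n - 1) ^ 2 * y ^ n := by rw [h]; ring
        rw [this]
        linear_combination (2 - x ^ n) * hxyn
      rw [this]
      exact mul_mem (mul_mem (natCast_mem _ p) (pow_mem hz 2)) (pow_mem hy n)
    have : V - 2 = p * ⟨_, hq⟩ := by
      apply Subtype.ext
      have : (p : ℚ) ≠ 0 := by exact_mod_cast hp.out.ne_zero
      push_cast
      field_simp
      rfl
    rw [← sub_eq_zero, ← map_ofNat (residueMap p) 2, ← map_sub, residueMap_eq_zero_iff]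
    exact ⟨_, this⟩
  · intro h
    have hV2 : residueMap p (V - 2) = 0 := by rw [map_sub, h, map_ofNat, sub_self]
    obtain ⟨v, hv⟩ := (residueMap_eq_zero_iff _).1 hV2
    have hU0 : residueMap p U = 0 := by
      have := congrArg (residueMap p) hVU
      rw [map_mul, hV2, zero_mul, map_mul, eq_comm, mul_eq_zero, or_iff_right hc4, map_pow] at this
      exact pow_eq_zero_iff two_ne_zero |>.1 this
    obtain ⟨u, hu⟩ := (residueMap_eq_zero_iff _).1 hU0
    -- `p ∣ U` gives `p² ∣ (V - 2)(V + 2)`, and `V + 2 ≡ 4` is a unit, so `p² ∣ V - 2`. The second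
    -- factor `p` is needed to divide `x^n - 1` itself by `p`, through its square.
    have hv0 : residueMap p v = 0 := by
      have e : v * (V + 2) = p * ((c ^ 2 - 4) * u ^ 2) := by
        apply mul_left_cancel₀ hp0
        rw [← mul_assoc, ← hv, hVU, hu]
        ring
      have := congrArg (residueMap p) e
      rw [map_mul, map_mul, map_natCast, ZMod.natCast_self, zero_mul, map_add, h, map_ofNat,
        mul_eq_zero, or_iff_left] at this
      · exact this
      · norm_num
        exact h4
    obtain ⟨w, hw⟩ := (residueMap_eq_zero_iff _).1 hv0
    refine ⟨(x ^ n - 1) / p, ?_, by field_simp⟩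
    have hsq : ((x ^ n - 1) / p) ^ 2 = x ^ n * f w := by
      have e := congrArg f (hv.trans (congrArg _ hw))
      simp only [map_mul, map_sub, map_natCast, map_ofNat, hVf] at e
      rw [div_pow, div_eq_iff (pow_ne_zero 2 hp0')]
      linear_combination x ^ n * e - hxyn
    have : IsIntegral (rationalPIntegers p) (((x ^ n - 1) / p) ^ 2) := by
      rw [hsq]
      exact mul_mem (pow_mem hx n) (algebraMap_mem_complexPIntegers w)
    exact this.of_pow two_pos

end Residue

/-! ### The individual conditions -/

section Conditions

variable {p : ℕ} [hp : Fact p.Prime]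

@[simp, norm_cast]
theorem coe_ofNat_rationalPIntegers (n : ℕ) [n.AtLeastTwo] :
    ((ofNat(n) : rationalPIntegers p) : ℚ) = ofNat(n) := rfl

theorem natCast_zmod_ne_zero_of_lt {n : ℕ} (h0 : 0 < n) (h : n < p) : (n : ZMod p) ≠ 0 := by
  rw [Ne, ZMod.natCast_eq_zero_iff]
  exact Nat.not_dvd_of_pos_of_lt h0 h

theorem three_ne_zero_zmod (hp3 : 3 < p) : (3 : ZMod p) ≠ 0 := by
  exact_mod_cast natCast_zmod_ne_zero_of_lt (n := 3) (by omega) hp3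

theorem numCubicSolutions_eq_ncard (a₀ a₁ a₂ a₃ : rationalPIntegers p) :
    numCubicSolutions p a₀ a₁ a₂ a₃ =
      {x : ZMod p | residueMap p a₀ * x ^ 3 + residueMap p a₁ * x ^ 2 + residueMap p a₂ * x +
        residueMap p a₃ = 0}.ncard := by
  have key : ∀ x : ℕ, CongrMod (rationalPIntegers p) p
      ((a₀ : ℚ) * (x : ℚ) ^ 3 + a₁ * (x : ℚ) ^ 2 + a₂ * (x : ℚ) + a₃) 0 ↔
      residueMap p a₀ * (x : ZMod p) ^ 3 + residueMap p a₁ * (x : ZMod p) ^ 2 +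
        residueMap p a₂ * (x : ZMod p) + residueMap p a₃ = 0 := by
    intro x
    have := congrMod_iff_residueMap_eq (a₀ * (x : rationalPIntegers p) ^ 3 + a₁ * (x : rationalPIntegers p) ^ 2 +
      a₂ * (x : rationalPIntegers p) + a₃) 0
    simpa using this
  refine Set.ncard_congr (fun x _ => (x : ZMod p)) ?_ ?_ ?_
  · rintro x ⟨-, hx⟩
    exact (key x).1 hx
  · rintro x y ⟨hx, -⟩ ⟨hy, -⟩ h
    exact Nat.ModEq.eq_of_lt_of_lt ((ZMod.natCast_eq_natCast_iff _ _ _).1 h) hx hy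
  · intro x hx
    refine ⟨x.val, ⟨x.val_lt, (key _).2 ?_⟩, ZMod.natCast_zmod_val x⟩
    rw [ZMod.natCast_zmod_val]
    exact hx

/-- The substitution `1 / x = (z - 1) / 3`. -/
theorem ncard_cubic_eq_ncard_chebyshev {F : Type*} [Field F] (h3 : (3 : F) ≠ 0) {A : F} (hA : A ≠ 0) :
    {x : F | A * x ^ 3 - x - 1 = 0}.ncard = {z : F | z ^ 3 - 3 * z = 27 * A - 2}.ncard := by
  refine Set.ncard_congr (fun x _ => 3 / x + 1) ?_ ?_ ?_
  · intro x (hx : A * x ^ 3 - x - 1 = 0)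
    have hx0 : x ≠ 0 := by rintro rfl; simp at hx
    change (3 / x + 1) ^ 3 - 3 * (3 / x + 1) = 27 * A - 2
    field_simp
    linear_combination (-27) * hx
  · intro x y _ _ h
    simpa [div_eq_mul_inv, h3] using h
  · intro z (hz : z ^ 3 - 3 * z = 27 * A - 2)
    have hz1 : z - 1 ≠ 0 := by
      intro h
      have h1 : 3 ^ 3 * A = 0 := by linear_combination (z ^ 2 + z - 2) * h - hz
      exact mul_ne_zero (pow_ne_zero 3 h3) hA h1
    refine ⟨3 / (z - 1), ?_, ?_⟩
    · change A * (3 / (z - 1)) ^ 3 - 3 / (z - 1) - 1 = 0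
      field_simp
      linear_combination -hz
    · field_simp
      ring

/-- The substitution `1 / x = -(z + 1)`. -/
theorem ncard_dual_cubic_eq_ncard_chebyshev {F : Type*} [Field F] {A : F} (hA : 27 * A - 4 ≠ 0) :
    {x : F | (27 * A - 4) * x ^ 3 + 3 * x + 1 = 0}.ncard =
      {z : F | z ^ 3 - 3 * z = 27 * A - 2}.ncard := by
  refine Set.ncard_congr (fun x _ => -(1 / x) - 1) ?_ ?_ ?_
  · intro x (hx : (27 * A - 4) * x ^ 3 + 3 * x + 1 = 0)
    have hx0 : x ≠ 0 := by rintro rfl; simp at hx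
    change (-(1 / x) - 1) ^ 3 - 3 * (-(1 / x) - 1) = 27 * A - 2
    field_simp
    linear_combination -hx
  · intro x y _ _ h
    simpa [div_eq_mul_inv] using h
  · intro z (hz : z ^ 3 - 3 * z = 27 * A - 2)
    have hz1 : z + 1 ≠ 0 := by
      intro h
      apply hA
      linear_combination (z ^ 2 - z - 2) * h - hz
    refine ⟨-(1 / (z + 1)), ?_, ?_⟩
    · change (27 * A - 4) * (-(1 / (z + 1))) ^ 3 + 3 * (-(1 / (z + 1))) + 1 = 0
      field_simp
      linear_combination hz
    · field_simp
      ring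

theorem lucasU_eq_zero_iff {K : Type*} [Field K] {A b : K} (hA : A ≠ 0) (h3 : (3 : K) ≠ 0)
    (hb : b ≠ 0) (hb1 : b ≠ 1) (hb1' : b ≠ -1) (hbA : b + b⁻¹ = 27 * A - 2) (n : ℕ) :
    lucasU (9 * A) (3 * A) n = 0 ↔ b ^ n = 1 := by
  have hb' : b + 1 ≠ 0 := fun h => hb1' (by linear_combination h)
  have h9 : (9 : K) ≠ 0 := by
    rw [show (9 : K) = 3 ^ 2 by norm_num]
    exact pow_ne_zero 2 h3
  have hq : (b + 1) ^ 2 = 27 * A * b := by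
    field_simp at hbA
    linear_combination hbA
  -- Chosen so that `b t` and `t` are the roots of `X² - 9A X + 3A`; the product comes out right
  -- because `(b + 1)² = 27 A b`.
  set t := 9 * A / (b + 1) with ht
  have ht0 : t ≠ 0 := div_ne_zero (mul_ne_zero h9 hA) hb'
  have hs : b * t + t = 9 * A := by
    rw [ht]
    field_simp
  have hm : b * t * t = 3 * A := by
    rw [ht]
    field_simp
    rw [hq]
    ring
  have h := sub_mul_lucasU (b * t) t n
  rw [hs, hm, mul_pow] at h
  have e : (b - 1) * t * lucasU (9 * A) (3 * A) n = t ^ n * (b ^ n - 1) := by linear_combination h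
  have hz : (b - 1) * t ≠ 0 := mul_ne_zero (sub_ne_zero.2 hb1) ht0
  rw [← sub_eq_zero (a := b ^ n)]
  constructor
  · intro h0
    rw [h0, mul_zero, eq_comm, mul_eq_zero] at e
    exact e.resolve_left (pow_ne_zero _ ht0)
  · intro h0
    rw [h0, mul_zero, mul_eq_zero] at e
    exact e.resolve_left hz

theorem sum_choose_three_mul_eq (hp3 : 3 < p) (A : ZMod p) :
    ∑ k ∈ Finset.Icc 1 (p / 3), (Nat.choose (3 * k) k : ZMod p) * A ^ k =
      ∑ k ∈ Finset.range (p / 3 + 1),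
        (Nat.choose (p / 3 + k) (2 * k) : ZMod p) * (-(27 * A - 2) - 2) ^ k - 1 := by
  have hpn : p = 3 * (p / 3) + 1 ∨ p = 3 * (p / 3) + 2 :=
    (cubicExponent_cases p hp3).imp And.left And.left
  have h : ∑ k ∈ Finset.range (p / 3 + 1),
        (Nat.choose (p / 3 + k) (2 * k) : ZMod p) * (-(27 * A - 2) - 2) ^ k =
      ∑ k ∈ Finset.range (p / 3 + 1), (Nat.choose (3 * k) k : ZMod p) * A ^ k := by
    refine Finset.sum_congr rfl fun k hk => ?_
    rw [cast_choose_three_mul _ hpn k (by simpa [Nat.lt_succ_iff] using hk),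
      show -(27 * A - 2) - 2 = -27 * A by ring, mul_pow]
    ring
  rw [h, Finset.sum_range_eq_add_Ico _ (Nat.succ_pos _)]
  simp [Finset.Ico_add_one_right_eq_Icc]

theorem congrMod_sum_choose_iff (hp3 : 3 < p) (a : rationalPIntegers p) {K : Type*} [Field K]
    [Algebra (ZMod p) K] {b : K} (hb : b ≠ 0)
    (hba : b + b⁻¹ = algebraMap (ZMod p) K (27 * residueMap p a - 2)) (h0 : residueMap p a ≠ 0)
    (h9 : 9 * residueMap p a ≠ 1) (h427 : 27 * residueMap p a ≠ 4) :
    CongrMod (rationalPIntegers p) p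
      (∑ k ∈ Finset.Icc 1 (p / 3), (Nat.choose (3 * k) k : ℚ) * (a : ℚ) ^ k) 0 ↔
      b ^ cubicExponent p = 1 := by
  have h3 := three_ne_zero_zmod hp3
  have h := congrMod_iff_residueMap_eq
    (∑ k ∈ Finset.Icc 1 (p / 3), (Nat.choose (3 * k) k : rationalPIntegers p) * a ^ k) 0
  simp only [map_sum, map_mul, map_natCast, map_pow, map_zero] at h
  push_cast at h
  rw [h, sum_choose_three_mul_eq hp3, sub_eq_zero]
  refine sum_choose_third_kind_eq_one_iff_pow_cubicExponent hp3 _ hb hba ?_ ?_ ?_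
  · intro h; apply h427; linear_combination h
  · intro h
    have h1 : 3 ^ 3 * residueMap p a = 0 := by linear_combination h
    exact mul_ne_zero (pow_ne_zero 3 h3) h0 h1
  · intro h; apply h9; apply mul_left_cancel₀ h3; linear_combination h

end Conditions

/-! ### The equivalence -/

theorem theorem2p1 (p : ℕ) [Fact p.Prime] (hp : 3 < p)
    (a : ℚ) (ha : a ∈ rationalPIntegers p)
    (ha0 : ¬ CongrMod (rationalPIntegers p) p a 0)
    (ha9 : ¬ CongrMod (rationalPIntegers p) p a (1 / 9))
    (ha27 : ¬ CongrMod (rationalPIntegers p) p a (1 / 27))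
    (ha427 : ¬ CongrMod (rationalPIntegers p) p a (4 / 27))
    (s : ℂ) (hs : s ^ 2 = 81 * (a : ℂ) ^ 2 - 12 * (a : ℂ)) :
    List.TFAE [
      CongrMod (rationalPIntegers p) p
        (∑ k ∈ Finset.Icc 1 (p / 3), (Nat.choose (3 * k) k : ℚ) * a ^ k) 0,
      CongrMod (rationalPIntegers p) p (lucasU (9 * a) (3 * a) (cubicExponent p)) 0,
      CongrMod (complexPIntegers p) p
        (((27 * (a : ℂ) - 2 + 3 * s) / 2) ^ cubicExponent p) 1,
      numCubicSolutions p a 0 (-1) (-1) = 3,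
      CongrMod (rationalPIntegers p) p
        (∑ k ∈ Finset.Icc 1 (p / 3),
          (Nat.choose (3 * k) k : ℚ) * ((4 - 27 * a) / 27) ^ k) 0,
      numCubicSolutions p (27 * a - 4) 0 3 1 = 3] := by
  have h3 := three_ne_zero_zmod hp
  have h27 : (27 : ZMod p) ≠ 0 := by
    rw [show (27 : ZMod p) = 3 ^ 3 by norm_num]
    exact pow_ne_zero 3 h3
  have h9 : (9 : ZMod p) ≠ 0 := by
    rw [show (9 : ZMod p) = 3 ^ 2 by norm_num]
    exact pow_ne_zero 2 h3
  have inv9 := inv_mem_rationalPIntegers (p := p) 9 (by rwa [map_ofNat])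
  have inv27 := inv_mem_rationalPIntegers (p := p) 27 (by rwa [map_ofNat])
  obtain ⟨i9, hi9⟩ : ∃ i : rationalPIntegers p, (i : ℚ) = 1 / 9 := ⟨⟨_, inv9⟩, by simp⟩
  obtain ⟨i27, hi27⟩ : ∃ i : rationalPIntegers p, (i : ℚ) = 1 / 27 := ⟨⟨_, inv27⟩, by simp⟩
  have r9 : 9 * residueMap p i9 = 1 := by
    rw [← map_ofNat (residueMap p) 9, ← map_mul, ← map_one (residueMap p)]
    congr 1
    apply Subtype.ext
    push_cast
    rw [hi9]
    norm_num
  have r27 : 27 * residueMap p i27 = 1 := by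
    rw [← map_ofNat (residueMap p) 27, ← map_mul, ← map_one (residueMap p)]
    congr 1
    apply Subtype.ext
    push_cast
    rw [hi27]
    norm_num
  lift a to rationalPIntegers p using ha
  set A := residueMap p a with hA
  have hA0 : A ≠ 0 := fun h => ha0 <| by
    have := (congrMod_iff_residueMap_eq a 0).2 (by rw [← hA, h, map_zero])
    simpa using this
  have hA9 : 9 * A ≠ 1 := fun h => ha9 <| by
    rw [← hi9, congrMod_iff_residueMap_eq]
    exact mul_left_cancel₀ h9 (h.trans r9.symm)
  have hA27 : 27 * A ≠ 1 := fun h => ha27 <| by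
    rw [← hi27, congrMod_iff_residueMap_eq]
    exact mul_left_cancel₀ h27 (h.trans r27.symm)
  have hA427 : 27 * A ≠ 4 := fun h => ha427 <| by
    have := (congrMod_iff_residueMap_eq a (4 * i27)).2 (by
      apply mul_left_cancel₀ h27
      rw [← hA, h, map_mul, map_ofNat]
      linear_combination -4 * r27)
    push_cast [hi27] at this
    convert this using 1
    change (4 / 27 : ℚ) = 4 * (1 / 27)
    norm_num
  have hA427' : 27 * A - 4 ≠ 0 := sub_ne_zero.2 hA427
  let K := AlgebraicClosure (ZMod p)
  have inj := (algebraMap (ZMod p) K).injective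
  obtain ⟨b, hb, hbA⟩ := exists_add_inv_eq (algebraMap (ZMod p) K (27 * A - 2))
  have hb1 : b ≠ 1 := by
    rintro rfl
    apply hA427
    apply inj
    simp only [map_mul, map_sub, map_ofNat, inv_one] at hbA ⊢
    linear_combination -hbA
  have hb1' : b ≠ -1 := by
    rintro rfl
    apply mul_ne_zero h27 hA0
    apply inj
    simp only [map_mul, map_sub, map_ofNat, inv_neg, inv_one, map_zero] at hbA ⊢
    linear_combination -hbA
  have hb2 : b ^ 2 ≠ 1 := by
    rw [Ne, sq_eq_one_iff]
    tauto
  have hcheb := ncard_chebyshev_cubic_eq_three_iff hp _ hb hbA hb2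
  have c1 := congrMod_sum_choose_iff hp a hb hbA hA0 hA9 hA427
  have c2 : CongrMod (rationalPIntegers p) p (lucasU (9 * (a : ℚ)) (3 * (a : ℚ)) (cubicExponent p)) 0 ↔
      b ^ cubicExponent p = 1 := by
    have h := congrMod_iff_residueMap_eq (lucasU (9 * a) (3 * a) (cubicExponent p)) 0
    rw [← Subring.subtype_apply, map_lucasU, map_lucasU, ← inj.eq_iff, map_lucasU] at h
    simp only [map_mul, map_ofNat, map_zero] at h
    refine h.trans (lucasU_eq_zero_iff ?_ ?_ hb hb1 hb1' ?_ _)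
    · simpa using hA0
    · rw [← map_ofNat (algebraMap (ZMod p) K) 3]
      simpa using h3
    · rw [hbA, map_sub, map_mul, map_ofNat, map_ofNat]
  have c3 : CongrMod (complexPIntegers p) p
      (((27 * ((a : ℚ) : ℂ) - 2 + 3 * s) / 2) ^ cubicExponent p) 1 ↔ b ^ cubicExponent p = 1 := by
    -- The inverse is the conjugate with `-s`, since `(27a - 2)² - 9s² = 4`.
    rw [congrMod_pow_one_iff hp (27 * a - 2) _ ((27 * ((a : ℚ) : ℂ) - 2 - 3 * s) / 2)
      (by linear_combination -(9 / 4) * hs) (by push_cast; ring)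
      (by
        have e : residueMap p ((27 * a - 2) ^ 2 - 4) = 27 * A * (27 * A - 4) := by
          simp only [map_sub, map_mul, map_pow, map_ofNat, ← hA]
          ring
        rw [e]
        exact mul_ne_zero (mul_ne_zero h27 hA0) hA427')]
    have e : algebraMap (ZMod p) K (residueMap p ((Polynomial.dickson 1 1 (cubicExponent p)).eval (27 * a - 2))) =
        b ^ cubicExponent p + b⁻¹ ^ cubicExponent p := by
      rw [← RingHom.comp_apply, ← Polynomial.eval_map_apply, Polynomial.map_dickson, map_one,
        RingHom.comp_apply, map_sub (residueMap p), map_mul (residueMap p), map_ofNat, map_ofNat, ← hA, ← hbA,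
        Polynomial.dickson_one_one_eval_add_inv _ _ (mul_inv_cancel₀ hb)]
    rw [← inj.eq_iff, e, map_ofNat, inv_pow]
    have hbn := pow_ne_zero (cubicExponent p) hb
    -- `v + v⁻¹ = 1 + 1⁻¹` only for `v = 1`.
    have := add_inv_eq_add_inv_iff (one_ne_zero) hbn
    rw [inv_one, or_self, one_add_one_eq_two] at this
    exact this
  have c4 : numCubicSolutions p a 0 (-1) (-1) = 3 ↔ b ^ cubicExponent p = 1 := by
    have h := numCubicSolutions_eq_ncard a 0 (-1) (-1)
    push_cast at h
    rw [h, ← hcheb, ← ncard_cubic_eq_ncard_chebyshev h3 hA0]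
    simp only [map_zero, map_neg, map_one, ← hA]
    ring_nf
  have c5 : CongrMod (rationalPIntegers p) p
        (∑ k ∈ Finset.Icc 1 (p / 3),
          (Nat.choose (3 * k) k : ℚ) * ((4 - 27 * (a : ℚ)) / 27) ^ k) 0 ↔ b ^ cubicExponent p = 1 := by
    have e : 27 * residueMap p ((4 - 27 * a) * i27) = 4 - 27 * A := by
      simp only [map_sub, map_mul, map_ofNat, ← hA]
      linear_combination (4 - 27 * A) * r27
    -- Replacing `a` by `4/27 - a` negates `27A - 2`, hence `b`. It swaps the excluded residues `0`
    -- and `4/27` and carries `1/27` to `1/9`.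
    have h := congrMod_sum_choose_iff hp ((4 - 27 * a) * i27) (neg_ne_zero.2 hb)
      (by rw [e, inv_neg, ← neg_add, hbA, ← map_neg]; congr 1; ring)
      (fun h => hA427 (by rw [h] at e; linear_combination e))
      (fun h => hA27 (by linear_combination e - 3 * h))
      (fun h => mul_ne_zero h27 hA0 (by linear_combination e - h))
    rw [(even_cubicExponent p hp).neg_pow] at h
    rw [← h]
    push_cast [hi27]
    rw [show (4 - 27 * (a : ℚ)) / 27 = (4 - 27 * (a : ℚ)) * (1 / 27) by ring]
  have c6 : numCubicSolutions p (27 * (a : ℚ) - 4) 0 3 1 = 3 ↔ b ^ cubicExponent p = 1 := by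
    have h := numCubicSolutions_eq_ncard (27 * a - 4) 0 3 1
    simp only [map_sub, map_mul, map_zero, map_one, map_ofNat, ← hA, zero_mul, add_zero] at h
    rw [ncard_dual_cubic_eq_ncard_chebyshev hA427'] at h
    rw [← hcheb, ← h]
    rfl
  rw [c1, c2, c3, c4, c5, c6]
  simp
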